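/- **Conventions.** A *barcode* is a multiset of intervals $[a,b)$ with $0\le a<b<\infty$ such that, for every $\epsilon>0$, only finitely many of its members (counted with multiplicity) have length greater than $\epsilon$; in particular every finite multiset of such intervals is a barcode. Put $d_\infty([a_1,b_1),[a_2,b_2))=\max(|a_1-a_2|,|b_1-b_2|)$ and $d_\infty([a,b),\emptyset)=d_\infty(\emptyset,[a,b))=|b-a|/2$. A *matching* between barcodes $B_1,B_2$ is a multi-subset $C$ of $(B_1\cup\{\emptyset\})\times(B_2\cup\{\emptyset\})$ not containing $(\emptyset,\emptyset)$, in which each interval occurs as a first (resp. second) coordinate exactly as many times as it occurs in $B_1$ (resp. $B_2$). The *bottleneck distance* is $d_{\mathcal B}(B_1,B_2)=\inf_C\sup_{(I,J)\in C}d_\infty(I,J)$, which is a finite real number. For a finite metric space $X$ and $\epsilon\ge 0$, the Vietoris–Rips complex $\mathrm{VR}_\epsilon(X)$ has as simplices the nonempty subsets of $X$ whose points are pairwise at distance $\le\epsilon$. Fix a field $F$ of coefficients. $\mathrm{PH}_k(X)$ denotes the barcode of the persistence module $\epsilon\mapsto \tilde H_k(\mathrm{VR}_\epsilon(X);F)$,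 $\epsilon\in[0,\infty)$ (reduced homology, with no truncation in $\epsilon$), that is, the multiset of intervals such that this module is isomorphic to the direct sum of the corresponding interval modules. A real-valued function $f$ on finite metric spaces is *extremely fragile* if there is a constant $c\in\mathbb N$ such that for every non-empty finite metric space $X$ and every real $N$ there exist a finite metric space $X'$ and an isometric embedding $X\to X'$ with $|X'|\le|X|+c$ and $|f(X')-f(X)|>N$. **Proposition 4.6.** Let $F$ be a field, let $B$ be a barcode and let $k\ge 0$ be an integer. Then the function $X\mapsto d_{\mathcal B}(B,\mathrm{PH}_k(X))$ from finite metric spaces to $\mathbb R$ is extremely fragile. -/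

import Mathlib

open scoped NNReal

universe u v

/-! ### Barcodes and the bottleneck distance -/

/-- A half-open interval `[birth, death)` with `0 ≤ birth < death < ∞`. -/
@[ext]
structure BarInterval where
  birth : ℝ
  death : ℝ
  birth_nonneg : 0 ≤ birth
  birth_lt_death : birth < death

/-- The length of the interval `[a, b)`. -/
def BarInterval.length (I : BarInterval) : ℝ := I.death - I.birth

/-- The parameter `t` lies in the interval `[a, b)`. -/
def BarInterval.Contains (I : BarInterval) (t : ℝ≥0) : Prop :=
  I.birth ≤ (t : ℝ) ∧ (t : ℝ) < I.death

/-- A barcode: a multiset of intervals `[a, b)`, given by its multiplicity function, such that for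
every `ε > 0` only finitely many of its members (counted with multiplicity) are longer than `ε`.
All finite multisets of intervals are barcodes in this sense. -/
structure Barcode where
  mult : BarInterval → ℕ
  finite_long : ∀ ε : ℝ, 0 < ε → {I | mult I ≠ 0 ∧ ε < I.length}.Finite

/-- The members of a barcode, where an interval of multiplicity `m` gives `m` members. -/
abbrev Barcode.Bars (A : Barcode) : Type := Σ I : BarInterval, Fin (A.mult I)

/-- The distance `d_∞` between two intervals, either of which may be empty (`none`). -/
noncomputable def barDist : Option BarInterval → Option BarInterval → ℝ
  | some I, some J => max |I.birth - J.birth| |I.death - J.death|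
  | some I, none => |I.death - I.birth| / 2
  | none, some J => |J.death - J.birth| / 2
  | none, none => 0

/-- A matching between barcodes `A` and `B`: a multi-subset `C` (given by its multiplicity function)
of `(A ∪ {∅}) × (B ∪ {∅})` which does not contain `(∅, ∅)` and in which each interval `I` occurs
as a first coordinate exactly as often as `I` occurs in `A`, and as a second coordinate exactly as
often as `I` occurs in `B`.  (A `HasSum` in `ℕ` is a sum with finitely many nonzero terms.) -/
structure IsMatching (A B : Barcode) (C : Option BarInterval × Option BarInterval → ℕ) : Prop where
  not_empty_empty : C (none, none) = 0
  fst : ∀ I : BarInterval, HasSum (fun J => C (some I, J)) (A.mult I)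
  snd : ∀ J : BarInterval, HasSum (fun I => C (I, some J)) (B.mult J)

/-- The infimum over all matchings `C` of `sup_{(I, J) ∈ C} d_∞(I, J)`, in `[0, ∞]`. -/
noncomputable def bottleneckEDist (A B : Barcode) : ENNReal :=
  ⨅ (C : Option BarInterval × Option BarInterval → ℕ) (_ : IsMatching A B C),
    ⨆ (p : Option BarInterval × Option BarInterval) (_ : C p ≠ 0),
      ENNReal.ofReal (barDist p.1 p.2)

/-- The lengths of the members of a barcode are bounded. -/
theorem Barcode.exists_length_le (A : Barcode) :
    ∃ r : ℝ, ∀ I, A.mult I ≠ 0 → |I.death - I.birth| / 2 ≤ r := by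
  obtain ⟨r, hr⟩ := ((A.finite_long 1 one_pos).image BarInterval.length).bddAbove
  refine ⟨max r 1, fun I hI => ?_⟩
  have hpos := I.birth_lt_death
  have h2 : |I.death - I.birth| = I.length := abs_of_pos (by linarith)
  have h3 : I.length ≤ max r 1 := by
    by_cases h : 1 < I.length
    · exact (hr ⟨I, ⟨hI, h⟩, rfl⟩).trans (le_max_left _ _)
    · exact (not_lt.1 h).trans (le_max_right _ _)
  have h4 : (1 : ℝ) ≤ max r 1 := le_max_right _ _
  rw [h2]
  linarith

/-- The bottleneck distance of two barcodes is finite: match every interval with `∅`. -/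
theorem bottleneckEDist_ne_top (A B : Barcode) : bottleneckEDist A B ≠ ⊤ := by
  classical
  obtain ⟨r, hr⟩ := A.exists_length_le
  obtain ⟨s, hs⟩ := B.exists_length_le
  let C : Option BarInterval × Option BarInterval → ℕ := fun p =>
    match p with
    | (some I, none) => A.mult I
    | (none, some J) => B.mult J
    | _ => 0
  have hC : IsMatching A B C := by
    refine ⟨rfl, fun I => ?_, fun J => ?_⟩
    · refine hasSum_single (f := fun J => C (some I, J)) none ?_
      rintro (_ | J) hJ
      · exact absurd rfl hJ
      · rfl
    · refine hasSum_single (f := fun I => C (I, some J)) none ?_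
      rintro (_ | I) hI
      · exact absurd rfl hI
      · rfl
  refine ne_top_of_le_ne_top (ENNReal.ofReal_ne_top (r := max r s)) ?_
  refine (iInf₂_le C hC).trans (iSup₂_le fun p hp => ENNReal.ofReal_le_ofReal ?_)
  obtain ⟨_ | I, _ | J⟩ := p
  · exact absurd rfl hp
  · exact (hs J hp).trans (le_max_right _ _)
  · exact (hr I hp).trans (le_max_left _ _)
  · exact absurd rfl hp

/-- The bottleneck distance `d_B(A, B)`, a real number by `bottleneckEDist_ne_top`. -/
noncomputable def bottleneckDist (A B : Barcode) : ℝ := (bottleneckEDist A B).toReal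

/-! ### Reduced simplicial homology with coefficients in a field -/

/-- The quotient `Z / (B ∩ Z)` for submodules `Z` and `B` of a module. -/
abbrev Subquotient {R M : Type*} [Ring R] [AddCommGroup M] [Module R M] (Z B : Submodule R M) :=
  Z ⧸ B.comap Z.subtype

/-- The map `Z / (B ∩ Z) → Z' / (B' ∩ Z')` induced by inclusions `Z ≤ Z'` and `B ≤ B'`. -/
def Subquotient.map {R M : Type*} [Ring R] [AddCommGroup M] [Module R M]
    {Z B Z' B' : Submodule R M} (hZ : Z ≤ Z') (hB : B ≤ B') :
    Subquotient Z B →ₗ[R] Subquotient Z' B' :=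
  Submodule.mapQ _ _ (Submodule.inclusion hZ) fun _ hx => hB hx

section Homology

variable (F : Type*) [Field F] {V : Type*}

/-- The ordered simplicial chains of `K`, spanned by the tuples `(v_0, …, v_{n-1})` of vertices,
possibly with repetitions, whose entries span a simplex of `K`; tuples of length `n` have degree
`n - 1`.  The empty tuple (degree `-1`) is included, so that the complex is augmented. -/
def orderedChains (K : AbstractSimplicialComplex V) (n : ℕ) : Submodule F ((Fin n → V) →₀ F) :=
  Finsupp.supported F F {σ | n = 0 ∨ (Set.finite_range σ).toFinset ∈ K}

/-- The boundary `(v_0, …, v_n) ↦ ∑ i, (-1)^i (v_0, …, v_{i-1}, v_{i+1}, …, v_n)`; in degree `0`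
it is the augmentation. -/
noncomputable def orderedBoundary (n : ℕ) : ((Fin (n + 1) → V) →₀ F) →ₗ[F] ((Fin n → V) →₀ F) :=
  Finsupp.linearCombination F fun σ : Fin (n + 1) → V =>
    ∑ i : Fin (n + 1), (-1 : F) ^ (i : ℕ) • Finsupp.single (i.removeNth σ) (1 : F)

/-- The reduced `k`-cycles of `K`. -/
noncomputable def simplicialCycles (K : AbstractSimplicialComplex V) (k : ℕ) :
    Submodule F ((Fin (k + 1) → V) →₀ F) :=
  orderedChains F K (k + 1) ⊓ LinearMap.ker (orderedBoundary F k)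

/-- The `k`-boundaries of `K`. -/
noncomputable def simplicialBoundaries (K : AbstractSimplicialComplex V) (k : ℕ) :
    Submodule F ((Fin (k + 1) → V) →₀ F) :=
  (orderedChains F K (k + 2)).map (orderedBoundary F (k + 1))

/-- The reduced `k`-th simplicial homology `Z_k / (B_k ∩ Z_k)` of `K` with coefficients in `F`. -/
abbrev ReducedHomology (K : AbstractSimplicialComplex V) (k : ℕ) :=
  Subquotient (simplicialCycles F K k) (simplicialBoundaries F K k)

variable {F}

theorem orderedChains_mono {K L : AbstractSimplicialComplex V} (h : K ≤ L) (n : ℕ) :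
    orderedChains F K n ≤ orderedChains F L n :=
  Finsupp.supported_mono fun _ hσ => hσ.imp_right fun hs => h hs

theorem simplicialCycles_mono {K L : AbstractSimplicialComplex V} (h : K ≤ L) (k : ℕ) :
    simplicialCycles F K k ≤ simplicialCycles F L k :=
  inf_le_inf_right _ (orderedChains_mono h _)

theorem simplicialBoundaries_mono {K L : AbstractSimplicialComplex V} (h : K ≤ L) (k : ℕ) :
    simplicialBoundaries F K k ≤ simplicialBoundaries F L k :=
  Submodule.map_mono (orderedChains_mono h _)

variable (F)

/-- The map on reduced homology induced by the inclusion of a subcomplex. -/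
noncomputable def reducedHomologyMap {K L : AbstractSimplicialComplex V} (h : K ≤ L) (k : ℕ) :
    ReducedHomology F K k →ₗ[F] ReducedHomology F L k :=
  Subquotient.map (simplicialCycles_mono h k) (simplicialBoundaries_mono h k)

end Homology

/-! ### Persistent homology of the Vietoris-Rips filtration -/

/-- The Vietoris-Rips complex: a nonempty finite set is a simplex iff its pairwise distances are
all at most `ε`. -/
def vietorisRips (X : Type*) [MetricSpace X] (ε : ℝ≥0) : AbstractSimplicialComplex X where
  faces := {s | s.Nonempty ∧ ∀ x ∈ s, ∀ y ∈ s, dist x y ≤ ε}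
  isRelLowerSet_faces := fun {_} hs =>
    ⟨hs.1, fun _ ht hne => ⟨hne, fun x hx y hy => hs.2 x (ht hx) y (ht hy)⟩⟩
  singleton_mem := fun v => ⟨Finset.singleton_nonempty v, fun x hx y hy => by
    rw [Finset.mem_singleton.1 hx, Finset.mem_singleton.1 hy, dist_self]
    exact ε.2⟩

theorem vietorisRips_mono (X : Type*) [MetricSpace X] {s t : ℝ≥0} (h : s ≤ t) :
    vietorisRips X s ≤ vietorisRips X t :=
  fun _ hs => ⟨hs.1, fun x hx y hy => (hs.2 x hx y hy).trans (NNReal.coe_le_coe.2 h)⟩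

/-- A persistence module over the field `F`, indexed by the scale parameter in `[0, ∞)`. -/
abbrev PersistenceModule (F : Type*) [Field F] := CategoryTheory.Functor ℝ≥0 (ModuleCat F)

/-- The `k`-th (reduced) persistent homology module of the Vietoris-Rips filtration of `X`. -/
noncomputable def ripsPersistence (F : Type*) [Field F] (k : ℕ) (X : Type*) [MetricSpace X] :
    PersistenceModule F where
  obj t := ModuleCat.of F (ReducedHomology F (vietorisRips X t) k)
  map f := ModuleCat.ofHom
    (reducedHomologyMap F (vietorisRips_mono X (CategoryTheory.leOfHom f)) k)
  map_id t := by
    ext x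
    rfl
  map_comp f g := by
    ext x
    rfl

/-- The barcode `A` describes the persistence module `M`: for every `t` there is a basis `e t` of
`M t` indexed by the bars of `A` that contain `t`, and for `s ≤ t` the map `M s → M t` sends the
basis vector of a bar to the basis vector of the same bar if that bar still contains `t`, and to `0`
otherwise.  Equivalently, `M` is isomorphic to the direct sum of the interval modules of the bars
of `A`. -/
def IsBarcodeOf {F : Type*} [Field F] (A : Barcode) (M : PersistenceModule F) : Prop :=
  ∃ e : ∀ t : ℝ≥0, Module.Basis {x : A.Bars // x.1.Contains t} F (M.obj t),
    ∀ (s t : ℝ≥0) (h : s ≤ t) (x : A.Bars) (hs : x.1.Contains s),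
      (∀ ht : x.1.Contains t,
        (M.map (CategoryTheory.homOfLE h)).hom (e s ⟨x, hs⟩) = e t ⟨x, ht⟩) ∧
      (¬ x.1.Contains t → (M.map (CategoryTheory.homOfLE h)).hom (e s ⟨x, hs⟩) = 0)

theorem intervalBasis_aux {F : Type*} [Field F] {ι : Type*} [LinearOrder ι] [Fintype ι]
    {M : ι → Type*} [∀ i, AddCommGroup (M i)] [∀ i, Module F (M i)]
    [∀ i, FiniteDimensional F (M i)]
    (f : ∀ i j, i ≤ j → M i →ₗ[F] M j)
    (hid : ∀ i x, f i i le_rfl x = x)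
    (hcomp : ∀ i j k (h : i ≤ j) (h' : j ≤ k) x, f j k h' (f i j h x) = f i k (h.trans h') x)
    (n : ℕ) :
    ∀ N : ∀ i, Submodule F (M i),
      (∀ i j h, ∀ x ∈ N i, f i j h x ∈ N j) → (∀ i, ∃ j, i ≤ j ∧ N j = ⊥) →
      ∑ i, Module.finrank F (N i) = n →
      ∃ (κ : Type) (_ : Finite κ) (b d : κ → ι) (e : κ → ∀ i, M i),
        (∀ x, b x < d x) ∧
        (∀ i, LinearIndepOn F (fun x => e x i) {x | b x ≤ i ∧ i < d x}) ∧
        (∀ i, Submodule.span F ((fun x => e x i) '' {x | b x ≤ i ∧ i < d x}) = N i) ∧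
        (∀ i j h x, b x ≤ i → f i j h (e x i) = e x j) ∧
        (∀ i x, d x ≤ i → e x i = 0) := by
  classical
  induction n using Nat.strong_induction_on with
  | _ n ih =>
  intro N hst htop hn
  by_cases hz : ∀ i, N i = ⊥
  · refine ⟨Empty, inferInstance, Empty.elim, Empty.elim, fun x => x.elim, fun x => x.elim,
      fun i => ?_, fun i => ?_, fun _ _ _ x => x.elim, fun _ x => x.elim⟩
    · rw [Set.eq_empty_of_isEmpty {x : Empty | _}]
      exact linearIndepOn_empty _ _
    · rw [Set.eq_empty_of_isEmpty {x : Empty | _}]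
      simp [hz i]
  push Not at hz
  -- the first index at which the module is nonzero, and a nonzero element there
  obtain ⟨i0, hi0, hmin⟩ : ∃ i0, N i0 ≠ ⊥ ∧ ∀ i, i < i0 → N i = ⊥ := by
    have hne : (Finset.univ.filter fun i => N i ≠ ⊥).Nonempty := by
      obtain ⟨i, hi⟩ := hz
      exact ⟨i, by simpa using hi⟩
    refine ⟨_, (Finset.mem_filter.1 (Finset.min'_mem _ hne)).2, fun i hi => ?_⟩
    by_contra hc
    exact absurd (Finset.min'_le _ i (by simpa using hc)) (not_le.2 hi)
  obtain ⟨v, hvN, hv⟩ := Submodule.exists_mem_ne_zero_of_ne_bot hi0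
  let u : ∀ i, M i := fun i => if h : i0 ≤ i then f i0 i h v else 0
  have hu : ∀ i (h : i0 ≤ i), u i = f i0 i h v := fun i h => dif_pos h
  have hfu : ∀ i j (h : i ≤ j), i0 ≤ i → f i j h (u i) = u j := fun i j h h0 => by
    rw [hu i h0, hu j (h0.trans h), hcomp]
  have huN : ∀ i, u i ∈ N i := fun i => by
    by_cases h : i0 ≤ i
    · rw [hu i h]; exact hst _ _ _ _ hvN
    · simp [u, h]
  -- the death index
  obtain ⟨d0, hd0, hud0, hdmin⟩ : ∃ d0, i0 ≤ d0 ∧ u d0 = 0 ∧ ∀ j, i0 ≤ j → j < d0 → u j ≠ 0 := by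
    have hne : (Finset.univ.filter fun i => i0 ≤ i ∧ u i = 0).Nonempty := by
      obtain ⟨j, hj, hNj⟩ := htop i0
      refine ⟨j, ?_⟩
      have := huN j
      rw [hNj, Submodule.mem_bot] at this
      simp [hj, this]
    have hm := (Finset.mem_filter.1 (Finset.min'_mem _ hne)).2
    refine ⟨_, hm.1, hm.2, fun j hj hlt h0 => ?_⟩
    exact absurd (Finset.min'_le _ j (by simp [hj, h0])) (not_le.2 hlt)
  have hlt : i0 < d0 := by
    refine lt_of_le_of_ne hd0 fun h => hv ?_
    subst h
    rw [← hid i0 v, ← hu i0 le_rfl, hud0]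
  -- the last index at which it is alive
  obtain ⟨p, hip, hpd, hpmax⟩ : ∃ p, i0 ≤ p ∧ p < d0 ∧ ∀ j, j < d0 → j ≤ p := by
    have hne : (Finset.univ.filter fun i => i < d0).Nonempty := ⟨i0, by simpa using hlt⟩
    have hm := (Finset.mem_filter.1 (Finset.max'_mem _ hne)).2
    refine ⟨_, Finset.le_max' _ _ (by simpa using hlt), hm, fun j hj => ?_⟩
    exact Finset.le_max' _ _ (by simpa using hj)
  obtain ⟨φ, hφ⟩ : ∃ φ : M p →ₗ[F] F, φ (u p) = 1 := by
    obtain ⟨g, hg⟩ := Module.Projective.exists_dual_ne_zero F (hdmin p hip hpd)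
    exact ⟨(g (u p))⁻¹ • g, by simp [hg]⟩
  let N' : ∀ i, Submodule F (M i) := fun i =>
    if h : i ≤ p then N i ⊓ LinearMap.ker (φ ∘ₗ f i p h) else N i
  have hN'1 : ∀ i (h : i ≤ p), N' i = N i ⊓ LinearMap.ker (φ ∘ₗ f i p h) := fun i h => dif_pos h
  have hN'2 : ∀ i, ¬ i ≤ p → N' i = N i := fun i h => dif_neg h
  have hle : ∀ i, N' i ≤ N i := fun i => by
    by_cases h : i ≤ p
    · rw [hN'1 i h]; exact inf_le_left
    · rw [hN'2 i h]
  have hφu : ∀ i (h : i ≤ p), i0 ≤ i → φ (f i p h (u i)) = 1 := fun i h h0 => by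
    rw [hfu _ _ _ h0, hφ]
  have hunot : ∀ i, i0 ≤ i → i < d0 → u i ∉ N' i := fun i h0 h1 hc => by
    rw [hN'1 i (hpmax i h1)] at hc
    have : φ (f i p _ (u i)) = 0 := hc.2
    rw [hφu i _ h0] at this
    exact one_ne_zero this
  have hst' : ∀ i j h, ∀ x ∈ N' i, f i j h x ∈ N' j := fun i j h x hx => by
    by_cases hj : j ≤ p
    · rw [hN'1 i (h.trans hj)] at hx
      rw [hN'1 j hj]
      refine ⟨hst _ _ _ _ hx.1, ?_⟩
      have h1 : φ (f i p _ x) = 0 := hx.2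
      change φ (f j p _ (f i j h x)) = 0
      rwa [hcomp]
    · rw [hN'2 j hj]
      exact hst _ _ _ _ (hle i hx)
  have hsum : ∑ i, Module.finrank F (N' i) < n := by
    rw [← hn]
    refine Finset.sum_lt_sum (fun i _ => Submodule.finrank_mono (hle i))
      ⟨i0, Finset.mem_univ _, Submodule.finrank_lt_finrank_of_lt ?_⟩
    refine lt_of_le_of_ne (hle i0) fun h => hunot i0 le_rfl hlt ?_
    rw [h]; exact huN i0
  obtain ⟨κ, hκ, b, d, e, hbd, hli, hsp, hmap, hdz⟩ := ih _ hsum N' hst'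
    (fun i => by
      obtain ⟨j, hj, h⟩ := htop i
      exact ⟨j, hj, by rw [← le_bot_iff, ← h]; exact hle j⟩) rfl
  have hsplit : ∀ i, {x : Option κ | (x.elim i0 b) ≤ i ∧ i < (x.elim d0 d)} =
      if i0 ≤ i ∧ i < d0 then insert none (some '' {x | b x ≤ i ∧ i < d x})
      else some '' {x | b x ≤ i ∧ i < d x} := fun i => by
    ext x
    split_ifs with h <;> cases x <;> simp [h]
  have himg : ∀ i, (fun x : Option κ => (x.elim u e) i) '' (some '' {x | b x ≤ i ∧ i < d x}) =
      (fun x => e x i) '' {x | b x ≤ i ∧ i < d x} := fun i => by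
    rw [Set.image_image]; rfl
  have hlis : ∀ i, LinearIndepOn F (fun x : Option κ => (x.elim u e) i)
      (some '' {x | b x ≤ i ∧ i < d x}) := fun i =>
    LinearIndepOn.image_of_comp _ _ (hli i)
  refine ⟨Option κ, inferInstance, fun x => x.elim i0 b, fun x => x.elim d0 d,
    fun x => x.elim u e, ?_, fun i => ?_, fun i => ?_, ?_, ?_⟩
  · rintro (_ | x)
    · exact hlt
    · exact hbd x
  · rw [hsplit]
    split_ifs with h
    · refine (hlis i).insert ?_
      rw [himg, hsp]
      exact hunot i h.1 h.2
    · exact hlis i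
  · rw [hsplit]
    split_ifs with h
    · rw [Set.image_insert_eq, Submodule.span_insert, himg, hsp]
      refine le_antisymm (sup_le ?_ (hle i)) fun x hx => ?_
      · rw [Submodule.span_singleton_le_iff_mem]; exact huN i
      · have hip := hpmax i h.2
        rw [Submodule.mem_sup]
        refine ⟨φ (f i p hip x) • u i, Submodule.smul_mem _ _ (Submodule.mem_span_singleton_self _),
          x - φ (f i p hip x) • u i, ?_, by abel⟩
        rw [hN'1 i hip]
        refine ⟨Submodule.sub_mem _ hx (Submodule.smul_mem _ _ (huN i)), ?_⟩
        simp [hφu i hip h.1]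
    · rw [himg, hsp]
      by_cases h0 : i0 ≤ i
      · have h1 : ¬ i < d0 := fun h1 => h ⟨h0, h1⟩
        exact hN'2 i fun hc => h1 (hc.trans_lt hpd)
      · have := hmin i (not_le.1 h0)
        rw [this, ← le_bot_iff, ← this]
        exact hle i
  · rintro i j h (_ | x) hx
    · exact hfu i j h hx
    · exact hmap i j h x hx
  · rintro i (_ | x) hx
    · change u i = 0
      change d0 ≤ i at hx
      rw [← hfu d0 i hx hd0, hud0, map_zero]
    · exact hdz i x hx

/-- A pointwise finite-dimensional persistence module which changes only at the finitely many
scales in `D` and vanishes for large scales has a barcode. -/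
theorem exists_isBarcodeOf {F : Type*} [Field F] (M : PersistenceModule F)
    (hfd : ∀ t, FiniteDimensional F (M.obj t)) (D : Finset ℝ≥0) (h0 : 0 ∈ D)
    (hconst : ∀ (s t : ℝ≥0) (h : s ≤ t), (∀ d ∈ D, d ≤ t → d ≤ s) →
      Function.Bijective (M.map (CategoryTheory.homOfLE h)).hom)
    (htop : ∃ d ∈ D, ∀ t, d ≤ t → ∀ x : M.obj t, x = 0) :
    ∃ A : Barcode, IsBarcodeOf A M := by
  classical
  have hMM : ∀ (i j k : ℝ≥0) (h : i ≤ j) (h' : j ≤ k) (x : M.obj i),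
      (M.map (CategoryTheory.homOfLE h')).hom ((M.map (CategoryTheory.homOfLE h)).hom x) =
        (M.map (CategoryTheory.homOfLE (h.trans h'))).hom x := fun i j k h h' x => by
    rw [← CategoryTheory.homOfLE_comp h h', M.map_comp]
    rfl
  have hr : ∀ t : ℝ≥0, ∃ r : D, r.1 ≤ t ∧ ∀ d : D, d.1 ≤ t → d ≤ r := fun t => by
    have hne : (D.filter fun d => d ≤ t).Nonempty := ⟨0, by simpa using h0⟩
    have hm := Finset.mem_filter.1 (Finset.max'_mem _ hne)
    exact ⟨⟨_, hm.1⟩, hm.2, fun d hd =>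
      Finset.le_max' _ _ (Finset.mem_filter.2 ⟨d.2, hd⟩)⟩
  choose r hrt hrmax using hr
  obtain ⟨κ, hκ, b, d, e, hbd, hli, hsp, hmap, hdz⟩ :=
    intervalBasis_aux (F := F) (ι := D) (M := fun i => M.obj i.1)
      (fun i j h => (M.map (CategoryTheory.homOfLE h)).hom)
      (fun i x => by
        change (M.map (CategoryTheory.CategoryStruct.id _)).hom x = x
        rw [M.map_id]; rfl)
      (fun i j k h h' x => hMM _ _ _ h h' x) _ (fun _ => ⊤) (fun _ _ _ _ _ => trivial)
      (fun i => by
        obtain ⟨d, hd, hz⟩ := htop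
        refine ⟨max i ⟨d, hd⟩, le_max_left _ _, ?_⟩
        rw [eq_bot_iff]
        intro x _
        exact hz _ (le_max_right (α := D) i ⟨d, hd⟩) x) rfl
  let β : κ → BarInterval := fun x => ⟨b x, d x, NNReal.coe_nonneg _, by exact_mod_cast hbd x⟩
  let A : Barcode :=
    { mult := fun I => Nat.card {x // β x = I}
      finite_long := fun ε _ => by
        refine (Set.finite_range β).subset ?_
        rintro I ⟨hI, -⟩
        obtain ⟨x⟩ := (Nat.card_ne_zero.1 hI).1
        exact ⟨x.1, x.2⟩ }
  let E : A.Bars ≃ κ :=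
    (Equiv.sigmaCongrRight fun I => (Finite.equivFin {x // β x = I}).symm).trans
      (Equiv.sigmaFiberEquiv β)
  have hE : ∀ x : A.Bars, β (E x) = x.1 := fun x =>
    ((Finite.equivFin {y // β y = x.1}).symm x.2).2
  have halive : ∀ (x : A.Bars) (t : ℝ≥0),
      x.1.Contains t ↔ b (E x) ≤ r t ∧ r t < d (E x) := fun x t => by
    rw [← hE x]
    have h1 : (β (E x)).Contains t ↔ (b (E x)).1 ≤ t ∧ t < (d (E x)).1 := by
      simp [BarInterval.Contains, β]
    rw [h1]
    constructor
    · rintro ⟨h, h'⟩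
      exact ⟨hrmax _ _ h, Subtype.coe_lt_coe.1 (lt_of_le_of_lt (hrt t) h')⟩
    · rintro ⟨h, h'⟩
      refine ⟨le_trans h (hrt t), ?_⟩
      by_contra hc
      exact absurd (hrmax t _ (not_lt.1 hc)) (not_le.2 h')
  have hbij : ∀ t, Function.Bijective (M.map (CategoryTheory.homOfLE (hrt t))).hom := fun t =>
    hconst _ _ (hrt t) fun c hc hct => hrmax t ⟨c, hc⟩ hct
  let w : ∀ t, {x : A.Bars // x.1.Contains t} → M.obj t := fun t x =>
    (M.map (CategoryTheory.homOfLE (hrt t))).hom (e (E x.1) (r t))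
  have hwli : ∀ t, LinearIndependent F (w t) := fun t => by
    have h1 : LinearIndependent F
        (fun x : {x : A.Bars // x.1.Contains t} => e (E x.1) (r t)) :=
      (hli (r t)).comp (fun x : {x : A.Bars // x.1.Contains t} =>
          (⟨E x.1, (halive _ _).1 x.2⟩ : {y | b y ≤ r t ∧ r t < d y}))
        (fun x y hxy => Subtype.ext (E.injective (congrArg Subtype.val hxy)))
    exact h1.map' _ (LinearMap.ker_eq_bot.2 (hbij t).1)
  have hwsp : ∀ t, ⊤ ≤ Submodule.span F (Set.range (w t)) := fun t => by
    have h1 : Set.range (w t) = (M.map (CategoryTheory.homOfLE (hrt t))).hom ''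
        ((fun x => e x (r t)) '' {x | b x ≤ r t ∧ r t < d x}) := by
      ext y
      constructor
      · rintro ⟨x, rfl⟩
        exact ⟨_, ⟨E x.1, (halive _ _).1 x.2, rfl⟩, rfl⟩
      · rintro ⟨_, ⟨x, hx, rfl⟩, rfl⟩
        refine ⟨⟨E.symm x, (halive _ _).2 (by simpa using hx)⟩, ?_⟩
        simp [w]
    rw [h1, Submodule.span_image, hsp, Submodule.map_top, LinearMap.range_eq_top.2 (hbij t).2]
  refine ⟨A, fun t => Module.Basis.mk (hwli t) (hwsp t), fun s t h x hs => ?_⟩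
  have hrr : r s ≤ r t := hrmax t _ ((hrt s).trans h)
  have key : (M.map (CategoryTheory.homOfLE h)).hom (w s ⟨x, hs⟩) =
      (M.map (CategoryTheory.homOfLE (hrt t))).hom (e (E x) (r t)) := by
    rw [← hmap _ _ hrr _ ((halive _ _).1 hs).1]
    simp only [w]
    rw [hMM, hMM]
  refine ⟨fun ht => ?_, fun ht => ?_⟩
  · rw [Module.Basis.mk_apply, Module.Basis.mk_apply, key]
  · rw [Module.Basis.mk_apply, key, hdz, map_zero]
    by_contra hc
    exact ht ((halive _ _).2 ⟨((halive _ _).1 hs).1.trans hrr, not_le.1 hc⟩)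

/-- A simplicial complex in which every nonempty finite set of vertices is a simplex has vanishing
reduced homology in degrees `k ≥ 0`. -/
theorem simplicialCycles_le_boundaries_of_full (F : Type*) [Field F] {V : Type*}
    (K : AbstractSimplicialComplex V) (hK : ∀ s : Finset V, s.Nonempty → s ∈ K) (k : ℕ) :
    simplicialCycles F K k ≤ simplicialBoundaries F K k := by
  intro z hz
  rcases isEmpty_or_nonempty V with hV | ⟨⟨v⟩⟩
  · have : z = 0 := by
      ext σ
      exact (IsEmpty.false (σ 0)).elim
    rw [this]
    exact Submodule.zero_mem _
  -- the cone operator with apex `v`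
  let c : ∀ n, ((Fin n → V) →₀ F) →ₗ[F] ((Fin (n + 1) → V) →₀ F) := fun n =>
    Finsupp.lmapDomain F F (fun σ => (Fin.cons v σ : Fin (n + 1) → V))
  have hc : ∀ y : (Fin (k + 1) → V) →₀ F,
      orderedBoundary F (k + 1) (c (k + 1) y) = y - c k (orderedBoundary F k y) := by
    intro y
    induction y using Finsupp.induction_linear with
    | zero => simp
    | add f g hf hg => rw [map_add, map_add, hf, hg, map_add, map_add]; abel
    | single σ a =>
      have h1 : c (k + 1) (Finsupp.single σ a) = Finsupp.single (Fin.cons v σ) a := by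
        simp [c]
      rw [h1]
      simp only [orderedBoundary, Finsupp.linearCombination_single]
      rw [Fin.sum_univ_succ]
      have h2 : ∀ i : Fin (k + 1), i.succ.removeNth (Fin.cons v σ : Fin (k + 2) → V) =
          Fin.cons v (i.removeNth σ) := fun i => by
        ext j
        refine Fin.cases ?_ (fun j => ?_) j
        · simp [Fin.removeNth]
        · simp [Fin.removeNth]
      have h3 : (0 : Fin (k + 2)).removeNth (Fin.cons v σ : Fin (k + 2) → V) = σ := by
        ext j
        simp [Fin.removeNth]
      simp only [h2, h3, map_smul, map_sum]
      simp [c, pow_succ, sub_eq_add_neg, Finset.sum_neg_distrib]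
  refine ⟨c (k + 1) z, ?_, ?_⟩
  · refine (Finsupp.mem_supported _ _).2 fun σ _ => Or.inr (hK _ ?_)
    rw [Set.Finite.toFinset_nonempty]
    exact Set.range_nonempty σ
  · have h0 : orderedBoundary F k z = 0 := hz.2
    rw [hc, h0, map_zero, sub_zero]

/-- The Vietoris-Rips persistent homology of a finite metric space has a barcode. -/
theorem exists_isBarcodeOf_ripsPersistence (F : Type*) [Field F] (k : ℕ) (X : Type*)
    [MetricSpace X] [Finite X] : ∃ A : Barcode, IsBarcodeOf A (ripsPersistence F k X) := by
  classical
  have := Fintype.ofFinite X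
  let D : Finset ℝ≥0 := insert 0 (Finset.univ.image fun p : X × X => nndist p.1 p.2)
  have hD : ∀ x y : X, nndist x y ∈ D := fun x y =>
    Finset.mem_insert_of_mem (Finset.mem_image.2 ⟨(x, y), Finset.mem_univ _, rfl⟩)
  have hne : D.Nonempty := ⟨0, Finset.mem_insert_self _ _⟩
  refine exists_isBarcodeOf _ (fun t => ?_) D (Finset.mem_insert_self _ _) (fun s t h hst => ?_)
    ⟨D.max' hne, D.max'_mem hne, fun t ht x => ?_⟩
  · change FiniteDimensional F (ReducedHomology F (vietorisRips X t) k)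
    infer_instance
  · have hK : vietorisRips X t = vietorisRips X s := by
      refine le_antisymm (fun u hu => ⟨hu.1, fun x hx y hy => ?_⟩) (vietorisRips_mono X h)
      have h1 : nndist x y ≤ t := by
        rw [← NNReal.coe_le_coe, coe_nndist]
        exact hu.2 x hx y hy
      rw [← coe_nndist, NNReal.coe_le_coe]
      exact hst _ (hD x y) h1
    have hgen : ∀ (K L : AbstractSimplicialComplex X) (hKL : K ≤ L), L = K →
        Function.Bijective (reducedHomologyMap F hKL k) := by
      rintro K L hKL rfl
      have : reducedHomologyMap F hKL k = LinearMap.id := by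
        ext x
        rfl
      rw [this]
      exact Function.bijective_id
    exact hgen _ _ (vietorisRips_mono X h) hK
  · have hfull := simplicialCycles_le_boundaries_of_full F (vietorisRips X t)
      (fun s hs => ⟨hs, fun x _ y _ => by
        rw [← coe_nndist, NNReal.coe_le_coe]
        exact (D.le_max' _ (hD x y)).trans ht⟩) k
    obtain ⟨x, rfl⟩ := Submodule.Quotient.mk_surjective _ x
    exact (Submodule.Quotient.mk_eq_zero _).2 (hfull x.2)

/-- The barcode `PH_k(X)` of the Vietoris-Rips persistent homology of a finite metric space `X`
with coefficients in the field `F` (reduced in degree `0`). -/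
noncomputable def persistentHomologyBarcode (F : Type*) [Field F] (k : ℕ) (X : Type*)
    [MetricSpace X] [Finite X] : Barcode :=
  (exists_isBarcodeOf_ripsPersistence F k X).choose

theorem persistentHomologyBarcode_spec (F : Type*) [Field F] (k : ℕ) (X : Type*)
    [MetricSpace X] [Finite X] :
    IsBarcodeOf (persistentHomologyBarcode F k X) (ripsPersistence F k X) :=
  (exists_isBarcodeOf_ripsPersistence F k X).choose_spec

/-! ### Extreme fragility -/

/-- A real-valued function `f` of finite metric spaces is extremely fragile if there is a constant
`c` such that every nonempty finite metric space `X` can, for every `N`, be isometrically embedded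
in a finite metric space `X'` with at most `c` more points such that `|f X' - f X| > N`. -/
def ExtremelyFragile (f : ∀ (X : Type u) [MetricSpace X] [Finite X], ℝ) : Prop :=
  ∃ c : ℕ, ∀ (X : Type u) [MetricSpace X] [Finite X] [Nonempty X] (N : ℝ),
    ∃ (X' : Type u) (_ : MetricSpace X') (_ : Finite X') (i : X → X'),
      Isometry i ∧ Nat.card X' ≤ Nat.card X + c ∧ N < |f X' - f X|

/-!
A barcode `B` has only finitely many members longer than `1`, so their deaths are bounded, and a bar
of length `L` in another barcode is at distance at least about `L / 2` from each member of `B` and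
from `∅` once `L` is large (`exists_forall_lt_bottleneckDist`).  It therefore suffices to add a
bounded number of points to `X` so that `PH_k` acquires an arbitrarily long bar.

For this, add the `2 (k + 1)` vertices of a `(k + 1)`-dimensional cross-polytope.  For `R` at least
the diameter of `X`, put antipodal vertices at distance `2 R`, other pairs of vertices at distance
`R`, and let all of `X` behave like a twin of one vertex (`crossMetric`).  The Vietoris-Rips complex
does not change on `[R, 2 R)`, and there its `k`-th reduced homology does not vanish
(`nontrivial_reducedHomology_of_cross`): the fundamental cycle `crossCycle` of the boundary sphere of the
cross-polytope is not a boundary, because the cocycle `crossCocycle`, dual to the facet of positive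
vertices, takes the value `1` on it.  Every bar alive at `R` then contains `[R, 2 R)`.
-/

/-! ### Long bars make the bottleneck distance large -/

/-- If the other barcode has a sufficiently long bar, its bottleneck distance to `B` is large. -/
theorem exists_forall_lt_bottleneckDist (B : Barcode) (M : ℝ) :
    ∃ R : ℝ, ∀ (A : Barcode) (I : BarInterval), A.mult I ≠ 0 → R ≤ I.length →
      M < bottleneckDist B A := by
  obtain ⟨S, hS⟩ := ((B.finite_long 1 one_pos).image BarInterval.death).bddAbove
  refine ⟨max (2 * (M + 1) + 1) (M + 1 + S), fun A I hI hR => ?_⟩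
  have h1 := (le_max_left _ _).trans hR
  have h2 := (le_max_right _ _).trans hR
  have hlen : I.length = I.death - I.birth := rfl
  have hb := I.birth_nonneg
  suffices h : ENNReal.ofReal (M + 1) ≤ bottleneckEDist B A by
    have := (ENNReal.ofReal_le_iff_le_toReal (bottleneckEDist_ne_top B A)).1 h
    exact (lt_add_one M).trans_le this
  refine le_iInf₂ fun C hC => ?_
  -- the partner of `I` in the matching
  obtain ⟨J, hJ⟩ : ∃ J, C (J, some I) ≠ 0 := by
    by_contra! hc
    have := hC.snd I
    simp only [hc] at this
    exact hI (this.unique hasSum_zero)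
  refine le_trans (ENNReal.ofReal_le_ofReal ?_) (le_iSup₂_of_le (J, some I) hJ le_rfl)
  obtain _ | J := J
  · have := le_abs_self (I.death - I.birth)
    simp only [barDist]
    linarith
  · have hJB : B.mult J ≠ 0 := fun h0 => by
      have := hC.fst J
      rw [h0, hasSum_zero_iff] at this
      exact hJ (this (some I))
    have h3 := neg_le_abs (J.death - I.death)
    have h4 := le_abs_self (J.birth - I.birth)
    have h5 := le_max_left |J.birth - I.birth| |J.death - I.death|
    have h6 := le_max_right |J.birth - I.birth| |J.death - I.death|
    simp only [barDist]
    by_cases hl : 1 < J.length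
    · have := hS ⟨J, ⟨hJB, hl⟩, rfl⟩
      linarith
    · have : J.length = J.death - J.birth := rfl
      linarith

/-! ### Homology of the boundary of a cross-polytope -/

section CrossPolytope

variable (F : Type*) [Field F] {V : Type*}

/-- For vertices labelled by the vertices `(j, ±)` of a cross-polytope, the `k`-cochain dual to the
facet of positive vertices: on a tuple labelled `(π 0, +), …, (π k, +)` for a permutation `π` it is
the sign of `π`, and it is `0` on all other tuples.  The sign is encoded as a determinant. -/
noncomputable def crossCocycle {n : ℕ} (l : V → Fin n × Bool) :
    ((Fin n → V) →₀ F) →ₗ[F] F :=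
  Finsupp.linearCombination F fun σ : Fin n → V =>
    (Matrix.of fun i j => if l (σ i) = (j, true) then (1 : F) else 0).det

/-- The cochain vanishes on the boundary of a tuple without antipodal labels: by Laplace expansion
along a column of ones the value is a determinant with linearly dependent columns. -/
theorem crossCocycle_orderedBoundary_single {k : ℕ} (l : V → Fin (k + 1) × Bool)
    (τ : Fin (k + 2) → V) (hτ : ∀ i i' j, l (τ i) = (j, true) → l (τ i') ≠ (j, false)) (a : F) :
    crossCocycle F l (orderedBoundary F (k + 1) (Finsupp.single τ a)) = 0 := by
  let N : Matrix (Fin (k + 2)) (Fin (k + 2)) F :=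
    Matrix.of fun i => Fin.cons 1 fun j => if l (τ i) = (j, true) then (1 : F) else 0
  have hdet : crossCocycle F l (orderedBoundary F (k + 1) (Finsupp.single τ a)) = a * N.det := by
    simp only [orderedBoundary, Finsupp.linearCombination_single, map_smul, map_sum, crossCocycle,
      smul_eq_mul, one_mul]
    rw [Matrix.det_succ_column_zero]
    congr 1
    refine Finset.sum_congr rfl fun i _ => ?_
    simp only [N, Matrix.of_apply, Fin.cons_zero, mul_one]
    rfl
  suffices h : N.det = 0 by rw [hdet, h, mul_zero]
  by_cases hneg : ∃ i j, l (τ i) = (j, false)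
  · obtain ⟨i, j, hij⟩ := hneg
    refine Matrix.det_eq_zero_of_column_eq_zero j.succ fun i' => ?_
    simp only [N, Matrix.of_apply, Fin.cons_succ]
    exact if_neg fun h => hτ _ _ _ h hij
  · -- all labels are positive, so the last `k + 1` columns add up to the column of ones
    push Not at hneg
    by_contra hN
    have hv : N.mulVec (Fin.cons (-1) fun _ => 1) = 0 := by
      ext i
      obtain ⟨j, hj⟩ : ∃ j, l (τ i) = (j, true) := by
        rcases h : l (τ i) with ⟨j, _ | _⟩
        · exact absurd h (hneg i j)
        · exact ⟨j, rfl⟩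
      simp [Matrix.mulVec, dotProduct, Fin.sum_univ_succ (n := k + 1), N, hj]
    have := congrFun (Matrix.eq_zero_of_mulVec_eq_zero hN hv) 0
    simp at this

/-- The fundamental cycle of the boundary sphere of a cross-polytope with vertices `p (j, ±)`: the
alternating sum of its facets. -/
noncomputable def crossCycle {n : ℕ} (p : Fin n × Bool → V) : (Fin n → V) →₀ F :=
  ∑ s : Fin n → Bool, (∏ i, if s i then (1 : F) else -1) •
    Finsupp.single (fun i => p (i, s i)) (1 : F)

theorem orderedBoundary_crossCycle {k : ℕ} (p : Fin (k + 1) × Bool → V) :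
    orderedBoundary F k (crossCycle F p) = 0 := by
  simp only [crossCycle, map_sum, map_smul, orderedBoundary, Finsupp.linearCombination_single,
    one_smul, Finset.smul_sum]
  rw [Finset.sum_comm]
  refine Finset.sum_eq_zero fun i _ => ?_
  -- the `i`-th faces of the two facets that differ only in the sign at `i` cancel
  rw [← (Fin.insertNthEquiv (fun _ => Bool) i).sum_comp, Fintype.sum_prod_type, Fintype.sum_bool,
    ← Finset.sum_add_distrib]
  refine Finset.sum_eq_zero fun s _ => ?_
  have h : ∀ b : Bool, (i.removeNth fun j => p (j, (i.insertNth b s : Fin (k + 1) → Bool) j)) =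
      fun j => p (i.succAbove j, s j) := fun b => by
    ext j
    simp [Fin.removeNth]
  simp only [Fin.insertNthEquiv_apply, h]
  simp [Fin.prod_univ_succAbove _ i]

theorem crossCocycle_crossCycle {n : ℕ} (l : V → Fin n × Bool) (p : Fin n × Bool → V)
    (hl : ∀ q, l (p q) = q) : crossCocycle F l (crossCycle F p) = 1 := by
  classical
  simp only [crossCycle, map_sum, map_smul, crossCocycle, Finsupp.linearCombination_single, hl]
  rw [Finset.sum_eq_single fun _ => true]
  · have : (Matrix.of fun i j : Fin n => if (i, true) = (j, true) then (1 : F) else 0) = 1 := by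
      ext i j
      simp [Matrix.one_apply]
    simp only [if_true, this, Matrix.det_one, Finset.prod_const_one, smul_eq_mul, mul_one]
  · intro s _ hs
    obtain ⟨i, hi⟩ := Function.ne_iff.1 hs
    rw [Matrix.det_eq_zero_of_row_eq_zero i fun j => by simp [hi], smul_zero, smul_zero]
  · simp

/-- A complex that contains the boundary of a cross-polytope, and whose vertices can be labelled
compatibly by the vertices of the cross-polytope without any simplex having two antipodal labels,
has nonvanishing reduced homology. -/
theorem nontrivial_reducedHomology_of_cross {k : ℕ} (K : AbstractSimplicialComplex V)
    (l : V → Fin (k + 1) × Bool) (p : Fin (k + 1) × Bool → V) (hl : ∀ q, l (p q) = q)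
    (hp : ∀ s : Fin (k + 1) → Bool, (Set.finite_range fun i => p (i, s i)).toFinset ∈ K)
    (hK : ∀ t ∈ K, ∀ v ∈ t, ∀ w ∈ t, ∀ j, l v = (j, true) → l w ≠ (j, false)) :
    Nontrivial (ReducedHomology F K k) := by
  have hz : crossCycle F p ∈ simplicialCycles F K k := by
    refine ⟨?_, orderedBoundary_crossCycle F p⟩
    exact Submodule.sum_mem _ fun s _ => Submodule.smul_mem _ _
      (Finsupp.single_mem_supported F _ (Or.inr (hp s)))
  have hzB : crossCycle F p ∉ simplicialBoundaries F K k := by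
    rintro ⟨c, hc, hcz⟩
    refine one_ne_zero (α := F) ?_
    rw [← crossCocycle_crossCycle F l p hl, ← hcz, ← c.sum_single, Finsupp.sum, map_sum, map_sum]
    refine Finset.sum_eq_zero fun τ hτ => crossCocycle_orderedBoundary_single F l τ ?_ _
    have hτK := ((Finsupp.mem_supported F c).1 hc hτ).resolve_left (Nat.succ_ne_zero _)
    intro i i' j
    exact hK _ hτK _ (by simp) _ (by simp) j
  refine Submodule.Quotient.nontrivial_iff.2 fun h => hzB ?_
  exact (Submodule.eq_top_iff'.1 h ⟨crossCycle F p, hz⟩ :)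

end CrossPolytope

/-! ### Attaching a cross-polytope to a metric space -/

/-- The distance of two distinct vertices of the cross-polytope: `2 R` if they are antipodal, `R`
otherwise.  The value `R` on the diagonal serves as the distance of a vertex to its twins. -/
noncomputable def crossDist {n : ℕ} (R : ℝ) (p q : Fin n × Bool) : ℝ :=
  if p.1 = q.1 ∧ p.2 ≠ q.2 then 2 * R else R

section CrossDist

variable {n : ℕ} {R : ℝ}

theorem crossDist_comm (p q : Fin n × Bool) : crossDist R p q = crossDist R q p := by
  simp only [crossDist, eq_comm, ne_comm]

theorem le_crossDist (hR : 0 < R) (p q : Fin n × Bool) : R ≤ crossDist R p q := by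
  unfold crossDist
  split_ifs <;> linarith

theorem crossDist_le (hR : 0 < R) (p q : Fin n × Bool) : crossDist R p q ≤ 2 * R := by
  unfold crossDist
  split_ifs <;> linarith

theorem crossDist_le_of_lt {t : ℝ} {p q : Fin n × Bool} (ht : t < 2 * R)
    (h : crossDist R p q ≤ t) : crossDist R p q ≤ R := by
  unfold crossDist at *
  split_ifs at * <;> linarith

end CrossDist

/-- The metric on the disjoint union of `X` and the vertices of a cross-polytope in which every
point of `X` has the same distances to the vertices as a twin of the vertex `(0, true)`. -/
@[reducible]
noncomputable def crossMetric (X : Type u) [MetricSpace X] (k : ℕ) {R : ℝ} (hR : 0 < R)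
    (hX : ∀ x y : X, dist x y ≤ R) : MetricSpace (X ⊕ Fin (k + 1) × Bool) where
  dist
    | .inl x, .inl y => dist x y
    | .inl _, .inr q => crossDist R (0, true) q
    | .inr p, .inl _ => crossDist R p (0, true)
    | .inr p, .inr q => if p = q then 0 else crossDist R p q
  dist_self := by rintro (x | p) <;> simp
  dist_comm := by
    rintro (x | p) (y | q)
    · exact dist_comm x y
    · exact crossDist_comm _ _
    · exact crossDist_comm _ _
    · simp only [eq_comm (a := p), crossDist_comm p]
  dist_triangle := by
    have h0 := le_crossDist (n := k + 1) hR
    have h2 := crossDist_le (n := k + 1) hR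
    rintro (x | p) (y | q) (z | r)
    · exact dist_triangle x y z
    · exact le_add_of_nonneg_left dist_nonneg
    · have := hX x z
      have := h0 (0, true) q
      have := h0 q (0, true)
      simp only
      linarith
    · simp only
      split_ifs with h
      · rw [h, add_zero]
      · linarith [h0 (0, true) q, h0 q r, h2 (0, true) r]
    · exact le_add_of_nonneg_right dist_nonneg
    · simp only
      split_ifs with h
      · linarith [h0 p (0, true), h0 (0, true) r]
      · linarith [h0 p (0, true), h0 (0, true) r, h2 p r]
    · simp only
      split_ifs with h
      · rw [h, zero_add]
      · linarith [h0 p q, h0 q (0, true), h2 p (0, true)]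
    · simp only
      split_ifs with h h' h'' h''
      · simp
      · linarith [h0 q r]
      · linarith [h0 p q]
      · linarith [h0 p q, h0 q r]
      · exact absurd (by rw [‹p = q›, ‹q = r›]) h
      · rw [‹p = q›, zero_add]
      · rw [‹q = r›, add_zero]
      · linarith [h0 p q, h0 q r, h2 p r]
  eq_of_dist_eq_zero := by
    have h0 := le_crossDist (n := k + 1) hR
    rintro (x | p) (y | q) h
    · rw [eq_of_dist_eq_zero h]
    · exact absurd h (hR.trans_le (h0 _ _)).ne'
    · exact absurd h (hR.trans_le (h0 _ _)).ne'
    · by_contra hpq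
      have hpq' : p ≠ q := fun h => hpq (h ▸ rfl)
      have h' : (if p = q then 0 else crossDist R p q) = 0 := h
      rw [if_neg hpq'] at h'
      exact absurd h' (hR.trans_le (h0 _ _)).ne'

/-- The Vietoris-Rips complex of the enlarged space is constant, and not acyclic, on `[R, 2 R)`, so
there is a bar that contains this range. -/
theorem exists_long_bar_crossMetric (F : Type v) [Field F] (X : Type u) [MetricSpace X] [Finite X]
    (k : ℕ) {R : ℝ} (hR : 0 < R) (hX : ∀ x y : X, dist x y ≤ R) :
    letI := crossMetric X k hR hX
    ∃ I, (persistentHomologyBarcode F k (X ⊕ Fin (k + 1) × Bool)).mult I ≠ 0 ∧ R ≤ I.length := by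
  let := crossMetric X k hR hX
  obtain ⟨e, he⟩ := persistentHomologyBarcode_spec F k (X ⊕ Fin (k + 1) × Bool)
  let r : ℝ≥0 := ⟨R, hR.le⟩
  have hconst : ∀ t : ℝ≥0, r ≤ t → (t : ℝ) < 2 * R →
      vietorisRips (X ⊕ Fin (k + 1) × Bool) t = vietorisRips (X ⊕ Fin (k + 1) × Bool) r := by
    refine fun t hrt ht => le_antisymm (fun s hs => ⟨hs.1, fun a ha b hb => ?_⟩)
      (vietorisRips_mono _ hrt)
    have hab := hs.2 a ha b hb
    rcases a with x | p <;> rcases b with y | q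
    · exact hX x y
    · exact crossDist_le_of_lt ht hab
    · exact crossDist_le_of_lt ht hab
    · change (if p = q then 0 else crossDist R p q) ≤ (t : ℝ) at hab
      change (if p = q then 0 else crossDist R p q) ≤ R
      split_ifs at hab ⊢
      · exact hR.le
      · exact crossDist_le_of_lt ht hab
  have hinj : ∀ (t : ℝ≥0) (h : r ≤ t), (t : ℝ) < 2 * R → Function.Injective
      ((ripsPersistence F k (X ⊕ Fin (k + 1) × Bool)).map (CategoryTheory.homOfLE h)).hom := by
    intro t h ht
    have hgen : ∀ (K L : AbstractSimplicialComplex (X ⊕ Fin (k + 1) × Bool)) (hKL : K ≤ L),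
        L = K → Function.Injective (reducedHomologyMap F hKL k) := by
      rintro K L hKL rfl
      have : reducedHomologyMap F hKL k = LinearMap.id := by
        ext x
        rfl
      rw [this]
      exact Function.injective_id
    exact hgen _ _ (vietorisRips_mono _ h) (hconst t h ht)
  have hhom := nontrivial_reducedHomology_of_cross (k := k) F
    (vietorisRips (X ⊕ Fin (k + 1) × Bool) r) (Sum.elim (fun _ => (0, true)) id) Sum.inr
    (fun _ => rfl) (fun s => ⟨by simpa using Set.range_nonempty _, fun a ha b hb => by
      obtain ⟨i, rfl⟩ := (Set.Finite.mem_toFinset _).1 ha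
      obtain ⟨j, rfl⟩ := (Set.Finite.mem_toFinset _).1 hb
      change (if (i, s i) = (j, s j) then 0 else crossDist R (i, s i) (j, s j)) ≤ R
      split_ifs
      · exact hR.le
      · rw [crossDist, if_neg]
        rintro ⟨rfl : i = j, h⟩
        exact h rfl⟩)
    (fun t ht v hv w hw j hvj hwj => by
      have hd := ht.2 v hv w hw
      have h2 : crossDist R (j, true) (j, false) = 2 * R := if_pos ⟨rfl, by simp⟩
      rcases w with w | w
      · simp at hwj
      · replace hwj : w = (j, false) := hwj
        subst hwj
        rcases v with v | v
        · replace hvj : ((0 : Fin (k + 1)), true) = (j, true) := hvj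
          replace hd : crossDist R (0, true) (j, false) ≤ R := hd
          rw [hvj, h2] at hd
          linarith
        · replace hvj : v = (j, true) := hvj
          subst hvj
          replace hd : (if (j, true) = (j, false) then 0 else crossDist R (j, true) (j, false)) ≤ R :=
            hd
          rw [if_neg (by simp), h2] at hd
          linarith)
  have hnt : Nontrivial ((ripsPersistence F k (X ⊕ Fin (k + 1) × Bool)).obj r) := hhom
  obtain ⟨⟨x, hx⟩⟩ := (e r).index_nonempty
  refine ⟨x.1, (Nat.zero_le _).trans_lt x.2.2 |>.ne', ?_⟩
  have hmem : ∀ t : ℝ≥0, r ≤ t → (t : ℝ) < 2 * R → x.1.Contains t := fun t h ht => by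
    by_contra hc
    exact (e r).ne_zero ⟨x, hx⟩ (hinj t h ht (((he r t h x hx).2 hc).trans (map_zero _).symm))
  have hbirth : x.1.birth ≤ R := hx.1
  have hdeath : 2 * R ≤ x.1.death := by
    by_contra! hc
    have hlt : R < x.1.death := hx.2
    exact lt_irrefl _ (hmem ⟨x.1.death, hR.le.trans hlt.le⟩ hlt.le hc).2
  have hlen : x.1.length = x.1.death - x.1.birth := rfl
  linarith

theorem proposition4p6 (F : Type v) [Field F] (B : Barcode) (k : ℕ) :
    ExtremelyFragile.{u} fun X [MetricSpace X] [Finite X] =>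
      bottleneckDist B (persistentHomologyBarcode F k X) := by
  refine ⟨2 * (k + 1), fun X _ _ _ N => ?_⟩
  obtain ⟨D, hD⟩ := (Set.finite_range fun p : X × X => dist p.1 p.2).bddAbove
  obtain ⟨R₀, hR₀⟩ := exists_forall_lt_bottleneckDist B
    (N + bottleneckDist B (persistentHomologyBarcode F k X))
  let R := max 1 (max D R₀)
  have hR : 0 < R := one_pos.trans_le (le_max_left _ _)
  have hX : ∀ x y : X, dist x y ≤ R := fun x y =>
    (hD ⟨(x, y), rfl⟩).trans ((le_max_left _ _).trans (le_max_right _ _))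
  obtain ⟨I, hI, hlen⟩ := exists_long_bar_crossMetric F X k hR hX
  let := crossMetric X k hR hX
  refine ⟨X ⊕ Fin (k + 1) × Bool, this, inferInstance, Sum.inl,
    Isometry.of_dist_eq fun _ _ => rfl, ?_, ?_⟩
  · simp [Nat.card_sum, mul_comm]
  · have h := hR₀ _ I hI (((le_max_right D R₀).trans (le_max_right 1 _)).trans hlen)
    exact (lt_sub_iff_add_lt.2 h).trans_le (le_abs_self _)
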